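/- Let $L^2(-1,1)$ be the real Hilbert space of square integrable functions for Lebesgue measure. For integers $0\le m\le n$ let \[ P_n(t)=\frac{(-1)^n}{2^n n!}\frac{\mathrm d^n}{\mathrm dt^n}\big((1-t^2)^n\big),\qquad Q_n^m(t)=\Big(\frac{2n+1}{2}\,\frac{(n-m)!}{(n+m)!}\Big)^{1/2}(1-t^2)^{m/2}P_n^{(m)}(t), \] so that, for each $m$, $\{Q_n^m : n\ge m\}$ is an orthonormal basis of $L^2(-1,1)$. For $s\ge 0$ let \[ \|u\|_{m,s}=\Big(\sum_{n=m}^\infty (2n+1)^{2s}\,|(u,Q_n^m)_{L^2(-1,1)}|^2\Big)^{1/2},\qquad H_m^s=\{u\in L^2(-1,1) : \|u\|_{m,s}<\infty\}. \] For $s<0$ let $H_m^s$ be the dual space of $H_m^{-s}$ (with $L^2(-1,1)$ identified with its own dual), that is, the space of all linear functionals on $H_m^{-s}$ that are bounded for $\|\cdot\|_{m,-s}$, with the dual norm $\|\cdot\|_{m,s}$. Then for all integers $m,m'\ge 1$ and all real $s$ with $-1\le s\le 1$, \[ H_m^s=H_{m'}^s \] with equivalent norms: there are constants $c,C>0$,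 depending only on $m$, $m'$ and $s$, such that \[ c\,\|u\|_{m',s}\le \|u\|_{m,s}\le C\,\|u\|_{m',s}\qquad\text{for all } u\in H_m^s . \] -/

import Mathlib

noncomputable section

namespace LegendreScale

open MeasureTheory Polynomial

/-- The real Hilbert space `L²(-1,1)` with respect to Lebesgue measure. -/
abbrev L2 : Type := Lp ℝ 2 (volume.restrict (Set.Ioo (-1 : ℝ) 1))

/-- The weight `ω(t) = √(1 - t²)`. -/
def omega (t : ℝ) : ℝ := Real.sqrt (1 - t ^ 2)

/-- The Legendre polynomial `P_n(t) = (-1)^n / (2^n n!) * (d/dt)^n (1 - t²)^n`. -/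
def legendreP (n : ℕ) : ℝ[X] :=
  C ((-1 : ℝ) ^ n / (2 ^ n * (n.factorial : ℝ))) * derivative^[n] ((1 - X ^ 2) ^ n)

/-- The normalization constant `c_{n,m} = ((2n+1)/2 * (n-m)!/(n+m)!)^{1/2}`, for `m ≤ n`. -/
def normConst (m n : ℕ) : ℝ :=
  Real.sqrt ((2 * (n : ℝ) + 1) / 2 * (((n - m).factorial : ℝ) / ((n + m).factorial : ℝ)))

/-- The normalized associated Legendre function
`Q_n^m(t) = c_{n,m} (1 - t²)^{m/2} P_n^{(m)}(t)`, for `m ≤ n`. -/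
def legendreFun (m n : ℕ) (t : ℝ) : ℝ :=
  normConst m n * (omega t ^ m * (derivative^[m] (legendreP n)).eval t)

theorem continuous_legendreFun (m n : ℕ) : Continuous (legendreFun m n) := by
  unfold legendreFun omega
  fun_prop

theorem memLp_legendreFun (m n : ℕ) :
    MemLp (legendreFun m n) 2 (volume.restrict (Set.Ioo (-1 : ℝ) 1)) := by
  obtain ⟨C, hC⟩ := (isCompact_Icc (a := (-1 : ℝ)) (b := 1)).exists_bound_of_continuousOn
    (continuous_legendreFun m n).continuousOn
  refine MemLp.of_bound (continuous_legendreFun m n).aestronglyMeasurable C ?_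
  filter_upwards [ae_restrict_mem measurableSet_Ioo] with t ht
  exact hC t (Set.Ioo_subset_Icc_self ht)

/-- `Q_n^m` as an element of `L²(-1,1)`. -/
def Q (m n : ℕ) : L2 := (memLp_legendreFun m n).toLp (legendreFun m n)

/-- The `k`-th term, with `n = m + k`, of `∑_{n ≥ m} (2n+1)^{2s} |(u, Q_n^m)|²`. -/
def weightedTerm (m : ℕ) (s : ℝ) (u : L2) (k : ℕ) : ℝ :=
  (2 * ((m + k : ℕ) : ℝ) + 1) ^ (2 * s) * (inner ℝ u (Q m (m + k))) ^ 2

theorem weightedTerm_nonneg (m : ℕ) (s : ℝ) (u : L2) (k : ℕ) : 0 ≤ weightedTerm m s u k := by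
  unfold weightedTerm
  positivity

/-- `H_m^s` for `s ≥ 0`: the subspace of all `u` in `L²(-1,1)` with
`∑_{n ≥ m} (2n+1)^{2s} |(u, Q_n^m)|² < ∞`. -/
def H (m : ℕ) (s : ℝ) : Submodule ℝ L2 where
  carrier := {u | Summable (weightedTerm m s u)}
  zero_mem' := by
    have h : weightedTerm m s 0 = fun _ => 0 := by
      funext k
      simp [weightedTerm]
    simp only [Set.mem_ofPred_eq, h]
    exact summable_zero
  add_mem' := by
    intro u v hu hv
    refine Summable.of_nonneg_of_le (weightedTerm_nonneg m s _) (fun k => ?_)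
      ((hu.add hv).mul_left 2)
    simp only [weightedTerm, inner_add_left]
    have hw : (0 : ℝ) ≤ (2 * ((m + k : ℕ) : ℝ) + 1) ^ (2 * s) := by positivity
    nlinarith [mul_nonneg hw
      (sq_nonneg (inner ℝ u (Q m (m + k)) - inner ℝ v (Q m (m + k))))]
  smul_mem' := by
    intro c u hu
    refine (hu.mul_left (c ^ 2)).congr (fun k => ?_)
    simp only [weightedTerm, real_inner_smul_left]
    ring

/-- The norm `‖u‖_{m,s} = (∑_{n ≥ m} (2n+1)^{2s} |(u, Q_n^m)|²)^{1/2}` on `H_m^s`, `s ≥ 0`. -/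
def scaleNorm (m : ℕ) (s : ℝ) (u : L2) : ℝ := Real.sqrt (∑' k, weightedTerm m s u k)

/-- `H_m^{-σ}` for `σ > 0`, as the dual of `H_m^σ` (`L²(-1,1)` being identified with its own dual):
the linear functionals with domain `H_m^σ` that are bounded for the norm `‖·‖_{m,σ}`. -/
def Hdual (m : ℕ) (σ : ℝ) : Set (L2 →ₗ.[ℝ] ℝ) :=
  {f | f.domain = H m σ ∧ ∃ K : ℝ, ∀ v : f.domain, |f v| ≤ K * scaleNorm m σ (v : L2)}

/-- The dual norm `‖f‖_{m,-σ}` on `H_m^{-σ}`, `σ > 0`: the least `K ≥ 0` such that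
`|f v| ≤ K ‖v‖_{m,σ}` for all `v` in `H_m^σ`. -/
def dualNorm (m : ℕ) (σ : ℝ) (f : L2 →ₗ.[ℝ] ℝ) : ℝ :=
  sInf {K : ℝ | 0 ≤ K ∧ ∀ v : f.domain, |f v| ≤ K * scaleNorm m σ (v : L2)}

end LegendreScale

end

noncomputable section

namespace LegendreScale

open MeasureTheory Polynomial

/-! ### Weighted integrals of polynomials -/

/-! The function `Q_n^m` is an eigenfunction, with eigenvalue `n(n+1)`, of the associated Legendre
operator, whose quadratic form is `a_m(f) = ∫ (1-t²) f'² + m² f²/(1-t²)`. Since `(2n+1)² = 4n(n+1) +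
1`, the squared norm for `s = 1` is `4 a_m(u) + ‖u‖²`. The order `m` enters `a_m` only as the
coefficient of the singular term, so for `m, m' ≥ 1` the forms are comparable. This is proved on
finite combinations of the `Q_n^{m'}` (`sum_mul_inner_sq_le`), by a Bessel inequality for the form
(`sum_mul_inner_sq_le_energy`).

For `s = 0` both norms are the `L²` norm, because the `Q_n^m` form a Hilbert basis (`basisQ`). The
range `0 < s < 1` follows by quadratic interpolation: the estimate passes to resolvent weights
`x/(t+x)` (`sum_resolvent_le_tsum`) and is integrated in `t` to produce `x^s`
(`sum_rpow_mul_inner_sq_le_tsum`). Negative `s` follows by duality.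

All functions involved have the form `ω^a p` with `p` a polynomial. For `a ≥ 1` the singular
quotient by `1-t²` then only lowers the exponent of `ω` in a product, so every integration by parts
is an instance of `weightedIntegral_derivative`. -/

theorem continuous_omega : Continuous omega := by
  unfold omega
  fun_prop

theorem omega_sq {t : ℝ} (ht : t ∈ Set.Icc (-1 : ℝ) 1) : omega t ^ 2 = 1 - t ^ 2 :=
  Real.sq_sqrt (by nlinarith [ht.1, ht.2])

theorem omega_pos {t : ℝ} (ht : t ∈ Set.Ioo (-1 : ℝ) 1) : 0 < omega t :=
  Real.sqrt_pos.2 (by nlinarith [ht.1, ht.2])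

theorem hasDerivAt_omega {t : ℝ} (ht : t ∈ Set.Ioo (-1 : ℝ) 1) :
    HasDerivAt omega (-t / omega t) t := by
  have h : HasDerivAt (fun x : ℝ => 1 - x ^ 2) (-(2 * t)) t := by
    simpa using (hasDerivAt_pow 2 t).const_sub 1
  have hne : 1 - t ^ 2 ≠ 0 := by nlinarith [ht.1, ht.2]
  refine HasDerivAt.congr_deriv (f := omega) (h.sqrt hne) ?_
  change -(2 * t) / (2 * omega t) = _
  ring

theorem continuous_omega_pow_mul_eval (k : ℕ) (r : ℝ[X]) :
    Continuous fun t => omega t ^ k * r.eval t :=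
  (continuous_omega.pow k).mul r.continuous

/-- The linear functional `r ↦ ∫_{-1}^1 ω^k r` on polynomials. -/
def weightedIntegral (k : ℕ) : ℝ[X] →ₗ[ℝ] ℝ where
  toFun r := ∫ t in (-1 : ℝ)..1, omega t ^ k * r.eval t
  map_add' p q := by
    simp only [eval_add, mul_add]
    exact intervalIntegral.integral_add
      ((continuous_omega_pow_mul_eval k p).intervalIntegrable _ _)
      ((continuous_omega_pow_mul_eval k q).intervalIntegrable _ _)
  map_smul' c p := by
    simp only [eval_smul, smul_eq_mul, mul_left_comm _ c, RingHom.id_apply]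
    exact intervalIntegral.integral_const_mul _ _

theorem weightedIntegral_apply (k : ℕ) (r : ℝ[X]) :
    weightedIntegral k r = ∫ t in (-1 : ℝ)..1, omega t ^ k * r.eval t := rfl

theorem weightedIntegral_C_mul (k : ℕ) (c : ℝ) (r : ℝ[X]) :
    weightedIntegral k (C c * r) = c * weightedIntegral k r := by
  rw [← smul_eq_C_mul, map_smul, smul_eq_mul]

theorem weightedIntegral_add_two (k : ℕ) (r : ℝ[X]) :
    weightedIntegral (k + 2) r = weightedIntegral k ((1 - X ^ 2) * r) := by
  refine intervalIntegral.integral_congr fun t ht => ?_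
  rw [Set.uIcc_of_le (by norm_num)] at ht
  simp only [pow_add, omega_sq ht, eval_mul, eval_sub, eval_one, eval_pow, eval_X]
  ring

/-- The derivative of `ω^{k+2} r` has vanishing integral. -/
theorem weightedIntegral_derivative (k : ℕ) (r : ℝ[X]) :
    weightedIntegral k ((1 - X ^ 2) * derivative r - C ((k : ℝ) + 2) * X * r) = 0 := by
  have hderiv : ∀ t ∈ Set.Ioo (-1 : ℝ) 1, HasDerivAt (fun x => omega x ^ (k + 2) * r.eval x)
      (omega t ^ k * ((1 - X ^ 2) * derivative r - C ((k : ℝ) + 2) * X * r).eval t) t := by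
    intro t ht
    have h0 := (omega_pos ht).ne'
    have h2 := omega_sq (Set.Ioo_subset_Icc_self ht)
    refine (((hasDerivAt_omega ht).fun_pow (k + 2)).fun_mul (r.hasDerivAt t)).congr_deriv ?_
    simp only [eval_sub, eval_mul, eval_one, eval_pow, eval_X, eval_C, ← h2]
    push_cast
    field_simp
    ring
  rw [weightedIntegral_apply, intervalIntegral.integral_eq_sub_of_hasDerivAt_of_le (by norm_num)
    (continuous_omega_pow_mul_eval (k + 2) r).continuousOn hderiv
    ((continuous_omega_pow_mul_eval k _).intervalIntegrable _ _)]
  simp [omega]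

theorem weightedIntegral_mul_self_nonneg (a : ℕ) (p : ℝ[X]) :
    0 ≤ weightedIntegral (a + a) (p * p) := by
  rw [weightedIntegral_apply]
  refine intervalIntegral.integral_nonneg (by norm_num) fun t _ => ?_
  rw [pow_add, eval_mul]
  nlinarith [mul_self_nonneg (omega t ^ a * p.eval t)]

theorem two_mul_weightedIntegral_le (a b : ℕ) (p q : ℝ[X]) :
    2 * weightedIntegral (a + b) (p * q) ≤
      weightedIntegral (a + a) (p * p) + weightedIntegral (b + b) (q * q) := by
  simp only [weightedIntegral_apply]
  rw [← intervalIntegral.integral_const_mul, ← intervalIntegral.integral_add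
    ((continuous_omega_pow_mul_eval _ _).intervalIntegrable _ _)
    ((continuous_omega_pow_mul_eval _ _).intervalIntegrable _ _)]
  refine intervalIntegral.integral_mono_on (by norm_num)
    (((continuous_omega_pow_mul_eval _ _).const_mul _).intervalIntegrable _ _)
    (((continuous_omega_pow_mul_eval _ _).add
      (continuous_omega_pow_mul_eval _ _)).intervalIntegrable _ _) fun t _ => ?_
  simp only [pow_add, eval_mul]
  nlinarith [sq_nonneg (omega t ^ a * p.eval t - omega t ^ b * q.eval t)]

/-! ### The Legendre differential equation -/

/-- Differentiate `(1-x²) w' = -2n x w`, satisfied by `w = (1-x²)^n`, a total of `k+1` times. The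
case `k = n + m` is the Legendre equation for `P_n^{(m)}`. -/
theorem derivative_one_sub_X_sq_pow (n k : ℕ) :
    (1 - X ^ 2) * derivative^[k + 2] ((1 - X ^ 2 : ℝ[X]) ^ n)
      - C (2 * ((k : ℝ) + 1 - n)) * X * derivative^[k + 1] ((1 - X ^ 2 : ℝ[X]) ^ n)
      + C (((k : ℝ) + 1) * (2 * n - k)) * derivative^[k] ((1 - X ^ 2 : ℝ[X]) ^ n) = 0 := by
  induction k with
  | zero =>
    have h : (1 - X ^ 2) * derivative ((1 - X ^ 2 : ℝ[X]) ^ n)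
        = -(C (2 * (n : ℝ)) * X * (1 - X ^ 2) ^ n) := by
      cases n with
      | zero => simp
      | succ n =>
        rw [derivative_pow_succ]
        simp only [derivative_sub, derivative_one, derivative_X_sq, map_mul, map_add, map_natCast,
          map_ofNat, map_one, Nat.cast_add, Nat.cast_one]
        ring
    have h' := congrArg derivative h
    simp only [derivative_mul, derivative_sub, derivative_one, derivative_X_sq, derivative_C,
      derivative_X, derivative_neg] at h'
    simp only [Function.iterate_succ, Function.iterate_zero, Function.comp_apply, id_eq,
      CharP.cast_eq_zero]
    simp only [map_mul, map_add, map_sub, map_natCast, map_ofNat, map_one, map_zero] at h' ⊢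
    linear_combination h'
  | succ k ih =>
    have h' := congrArg derivative ih
    simp only [derivative_mul, derivative_sub, derivative_add, derivative_one, derivative_X_sq,
      derivative_C, derivative_X, derivative_zero, ← Function.iterate_succ_apply'] at h'
    simp only [map_mul, map_add, map_sub, map_natCast, map_ofNat, map_one, Nat.cast_add,
      Nat.cast_one, Nat.succ_eq_add_one, add_assoc] at h' ⊢
    norm_num only at h' ⊢
    linear_combination h'

theorem derivative_legendreP (m n : ℕ) :
    derivative^[m] (legendreP n) = C ((-1 : ℝ) ^ n / (2 ^ n * (n.factorial : ℝ))) *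
      derivative^[n + m] ((1 - X ^ 2) ^ n) := by
  rw [legendreP, iterate_derivative_C_mul, ← Function.iterate_add_apply, add_comm m n]

/-- The Legendre equation, differentiated `m` times. -/
theorem legendreP_equation (m n : ℕ) :
    (1 - X ^ 2) * derivative^[m + 2] (legendreP n)
      - C (2 * ((m : ℝ) + 1)) * X * derivative^[m + 1] (legendreP n)
      + C (((n : ℝ) - m) * (n + m + 1)) * derivative^[m] (legendreP n) = 0 := by
  simp only [derivative_legendreP]
  have h := derivative_one_sub_X_sq_pow n (n + m)
  simp only [map_mul, map_add, map_sub, map_natCast, map_ofNat, map_one, Nat.cast_add,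
    ← add_assoc] at h ⊢
  linear_combination (C ((-1 : ℝ) ^ n / (2 ^ n * (n.factorial : ℝ)))) * h

theorem natDegree_one_sub_X_sq_pow (n : ℕ) : ((1 - X ^ 2 : ℝ[X]) ^ n).natDegree = 2 * n := by
  have : (1 - X ^ 2 : ℝ[X]).natDegree = 2 := by compute_degree!
  rw [natDegree_pow, this, mul_comm]

theorem coeff_one_sub_X_sq_pow (n : ℕ) : ((1 - X ^ 2 : ℝ[X]) ^ n).coeff (2 * n) = (-1) ^ n := by
  have h2 : (1 - X ^ 2 : ℝ[X]).natDegree = 2 := by compute_degree!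
  have h := coeff_pow_mul_natDegree (1 - X ^ 2 : ℝ[X]) n
  rw [h2, mul_comm n 2] at h
  rw [h, leadingCoeff, h2]
  simp [coeff_one]

theorem natDegree_derivative_legendreP_le (m k : ℕ) :
    (derivative^[m] (legendreP (m + k))).natDegree ≤ k := by
  rw [derivative_legendreP]
  refine (natDegree_C_mul_le _ _).trans ((natDegree_iterate_derivative _ _).trans ?_)
  rw [natDegree_one_sub_X_sq_pow]
  omega

theorem coeff_derivative_legendreP (m k : ℕ) :
    (derivative^[m] (legendreP (m + k))).coeff k =
      ((2 * (m + k)).factorial : ℝ) / (2 ^ (m + k) * (m + k).factorial * k.factorial) := by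
  have hk : k + (m + k + m) = 2 * (m + k) := by ring
  rw [derivative_legendreP, coeff_C_mul, coeff_iterate_derivative, hk, coeff_one_sub_X_sq_pow,
    nsmul_eq_mul]
  have h := Nat.factorial_mul_descFactorial (n := 2 * (m + k)) (k := m + k + m) (by omega)
  have hk' : 2 * (m + k) - (m + k + m) = k := by omega
  rw [hk'] at h
  rw [← h]
  have h1 : ((-1 : ℝ) ^ (m + k)) * (-1) ^ (m + k) = 1 := by
    rw [← mul_pow]; norm_num
  push_cast
  have h3 : ((m + k).factorial : ℝ) ≠ 0 := by positivity
  have h4 : (k.factorial : ℝ) ≠ 0 := by positivity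
  field_simp
  linear_combination (((2 * (m + k)).descFactorial (m + k + m) : ℝ)) * h1

theorem degree_derivative_legendreP (m k : ℕ) :
    (derivative^[m] (legendreP (m + k))).degree = k := by
  refine le_antisymm (degree_le_of_natDegree_le (natDegree_derivative_legendreP_le m k)) ?_
  refine le_degree_of_ne_zero ?_
  rw [coeff_derivative_legendreP]
  positivity

/-! ### Normalization -/

theorem weightedIntegral_one_succ (n : ℕ) :
    (2 * (n : ℝ) + 3) * weightedIntegral (2 * n + 2) 1
      = (2 * n + 2) * weightedIntegral (2 * n) 1 := by
  -- The choice `r = X` gives the reduction formula for `∫ (1-t²)^n`.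
  have h := weightedIntegral_derivative (2 * n) X
  have e : (1 - X ^ 2) * derivative X - C (((2 * n : ℕ) : ℝ) + 2) * X * X
      = C (2 * (n : ℝ) + 3) * ((1 - X ^ 2) * 1) - C (2 * (n : ℝ) + 2) * (1 : ℝ[X]) := by
    simp only [derivative_X, map_mul, map_add, map_natCast, map_ofNat, Nat.cast_mul, Nat.cast_ofNat]
    ring
  rw [e, map_sub, weightedIntegral_C_mul, weightedIntegral_C_mul, ← weightedIntegral_add_two] at h
  linarith

theorem weightedIntegral_one (n : ℕ) :
    weightedIntegral (2 * n) 1 =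
      2 ^ (2 * n + 1) * (n.factorial : ℝ) ^ 2 / ((2 * n + 1).factorial : ℝ) := by
  induction n with
  | zero => norm_num [weightedIntegral_apply]
  | succ n ih =>
    have h := weightedIntegral_one_succ n
    rw [ih] at h
    have e : 2 * (n + 1) + 1 = (2 * n + 1) + 1 + 1 := by ring
    have h0 : (2 * (n : ℝ) + 3) ≠ 0 := by positivity
    rw [e, Nat.factorial_succ (2 * n + 1 + 1), Nat.factorial_succ (2 * n + 1), Nat.factorial_succ n]
    apply mul_left_cancel₀ h0
    rw [show 2 * (n + 1) = 2 * n + 2 by ring, h]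
    push_cast
    field_simp
    ring

/-- Integrate the derivative of `ω^{2m+2} P_n^{(m)} P_n^{(m+1)}` and eliminate the second-order term
with the Legendre equation. -/
theorem weightedIntegral_derivative_legendreP_succ (m n : ℕ) :
    weightedIntegral (2 * (m + 1))
        (derivative^[m + 1] (legendreP n) * derivative^[m + 1] (legendreP n))
      = ((n : ℝ) - m) * (n + m + 1) * weightedIntegral (2 * m)
        (derivative^[m] (legendreP n) * derivative^[m] (legendreP n)) := by
  have h := weightedIntegral_derivative (2 * m)
    (derivative^[m] (legendreP n) * derivative^[m + 1] (legendreP n))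
  have ode := legendreP_equation m n
  rw [derivative_mul, ← Function.iterate_succ_apply' derivative,
    ← Function.iterate_succ_apply' derivative] at h
  rw [show 2 * (m + 1) = 2 * m + 2 by ring, weightedIntegral_add_two, ← weightedIntegral_C_mul,
    ← sub_eq_zero, ← map_sub, ← h]
  congr 1
  simp only [map_mul, map_add, map_sub, map_natCast, map_ofNat, map_one, Nat.cast_mul,
    Nat.cast_ofNat, Nat.succ_eq_add_one, add_assoc] at ode ⊢
  norm_num only at ode ⊢
  linear_combination (-derivative^[m] (legendreP n)) * ode

/-- The degree `n = m + k` stays fixed while the order rises to `m = n`, where `P_n^{(n)}` is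
constant; hence the induction on `k` with `m` generalized. -/
theorem weightedIntegral_derivative_legendreP (m k : ℕ) :
    weightedIntegral (2 * m)
        (derivative^[m] (legendreP (m + k)) * derivative^[m] (legendreP (m + k)))
      = 2 / (2 * ((m + k : ℕ) : ℝ) + 1) *
        (((m + k + m).factorial : ℝ) / (k.factorial : ℝ)) := by
  induction k generalizing m with
  | zero =>
    have h := eq_C_of_natDegree_le_zero (natDegree_derivative_legendreP_le m 0)
    rw [coeff_derivative_legendreP] at h
    rw [h, ← C_mul, ← mul_one (C _), weightedIntegral_C_mul, add_zero, weightedIntegral_one,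
      Nat.factorial_succ, ← two_mul]
    push_cast
    have h3 : (m.factorial : ℝ) ≠ 0 := by positivity
    have h4 : ((2 * m).factorial : ℝ) ≠ 0 := by positivity
    simp only [Nat.factorial_zero, Nat.cast_one]
    field_simp
    ring
  | succ k ih =>
    have h := weightedIntegral_derivative_legendreP_succ m (m + (k + 1))
    have e : m + (k + 1) = m + 1 + k := by ring
    rw [e, ih (m + 1), ← e, show m + (k + 1) + (m + 1) = m + (k + 1) + m + 1 by ring,
      Nat.factorial_succ] at h
    rw [Nat.factorial_succ k]
    push_cast at h ⊢
    have h1 : ((m : ℝ) + (k + 1) - m) * (m + (k + 1) + m + 1) ≠ 0 := by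
      have : ((m : ℝ) + (k + 1) - m) = k + 1 := by ring
      rw [this]
      positivity
    apply mul_left_cancel₀ h1
    rw [← h]
    field_simp
    ring

/-! ### The energy form of the associated Legendre operator -/

/-- The polynomial factor of `Q_n^m = ω^m · (c_{n,m} P_n^{(m)})`. -/
def legendreFactor (m n : ℕ) : ℝ[X] := C (normConst m n) * derivative^[m] (legendreP n)

/-- The polynomial `d` with `(1 - t²) (ω^a p)' = ω^a d`. -/
def weightedDerivative (a : ℕ) : ℝ[X] →ₗ[ℝ] ℝ[X] :=
  LinearMap.mulLeft ℝ (1 - X ^ 2) ∘ₗ derivative - LinearMap.mulLeft ℝ (C (a : ℝ) * X)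

theorem weightedDerivative_apply (a : ℕ) (p : ℝ[X]) :
    weightedDerivative a p = (1 - X ^ 2) * derivative p - C (a : ℝ) * X * p := by
  simp [weightedDerivative, mul_assoc]

/-- The form `∫ (1 - t²) f' g' + c f g / (1 - t²)` for `f = ω^{α+1} p` and `g = ω^{β+1} q`, as a
linear functional of `q`. -/
def energy (c : ℝ) (α β : ℕ) (p : ℝ[X]) : ℝ[X] →ₗ[ℝ] ℝ :=
  weightedIntegral (α + β) ∘ₗ
    (LinearMap.mulLeft ℝ (weightedDerivative (α + 1) p) ∘ₗ weightedDerivative (β + 1)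
      + c • LinearMap.mulLeft ℝ p)

theorem energy_apply (c : ℝ) (α β : ℕ) (p q : ℝ[X]) :
    energy c α β p q =
      weightedIntegral (α + β) (weightedDerivative (α + 1) p * weightedDerivative (β + 1) q)
        + c * weightedIntegral (α + β) (p * q) := by
  simp [energy]

theorem energy_comm (c : ℝ) (α β : ℕ) (p q : ℝ[X]) :
    energy c α β p q = energy c β α q p := by
  simp only [energy_apply, add_comm α β, mul_comm p q,
    mul_comm (weightedDerivative (α + 1) p)]

theorem two_mul_energy_le {c : ℝ} (hc : 0 ≤ c) (α β : ℕ) (p q : ℝ[X]) :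
    2 * energy c α β p q ≤ energy c α α p p + energy c β β q q := by
  simp only [energy_apply]
  have h1 := two_mul_weightedIntegral_le α β (weightedDerivative (α + 1) p)
    (weightedDerivative (β + 1) q)
  have h2 := mul_le_mul_of_nonneg_left (two_mul_weightedIntegral_le α β p q) hc
  linarith

theorem energy_le_mul_energy {c c' K : ℝ} (hK : 1 ≤ K) (hc : c ≤ K * c') (α : ℕ) (p : ℝ[X]) :
    energy c α α p p ≤ K * energy c' α α p p := by
  simp only [energy_apply]
  have h1 := weightedIntegral_mul_self_nonneg α (weightedDerivative (α + 1) p)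
  have h2 := weightedIntegral_mul_self_nonneg α p
  nlinarith [mul_le_mul_of_nonneg_right hK h1, mul_le_mul_of_nonneg_right hc h2]

/-- The equation says that `ω^{β+1} q` is an eigenfunction of the operator of order `β+1` for `L`.
One integration by parts against `ω^{α+1} p` suffices, the boundary term being `ω^{α+β+2}` times a
polynomial. Only `q` solves an equation, so `α` is free: this is what lets functions of different
orders be paired. -/
theorem energy_of_equation {β : ℕ} {L : ℝ} {q : ℝ[X]}
    (ode : (1 - X ^ 2) * derivative (derivative q)
      - C (2 * (((β + 1 : ℕ) : ℝ) + 1)) * X * derivative q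
      + C (L - (β + 1 : ℕ) * ((β + 1 : ℕ) + 1)) * q = 0) (α : ℕ) (p : ℝ[X]) :
    energy (((β + 1 : ℕ) : ℝ) ^ 2) α β p q = L * weightedIntegral (α + 1 + (β + 1)) (p * q) := by
  have h := weightedIntegral_derivative (α + β) (p * weightedDerivative (β + 1) q)
  rw [show α + 1 + (β + 1) = α + β + 2 by ring, weightedIntegral_add_two, energy_apply,
    ← weightedIntegral_C_mul, ← weightedIntegral_C_mul, ← map_add, ← sub_eq_zero, ← map_sub, ← h]
  congr 1
  simp only [weightedDerivative_apply, derivative_mul, derivative_sub, derivative_one,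
    derivative_X_sq, derivative_C, derivative_X]
  simp only [map_mul, map_add, map_sub, map_pow, map_natCast, map_ofNat, map_one,
    Nat.cast_add, Nat.cast_one] at ode ⊢
  linear_combination (-p * (1 - X ^ 2)) * ode

theorem energy_legendreFactor (α β n : ℕ) (p : ℝ[X]) :
    energy (((β + 1 : ℕ) : ℝ) ^ 2) α β p (legendreFactor (β + 1) n) =
      (n : ℝ) * (n + 1) * weightedIntegral (α + 1 + (β + 1)) (p * legendreFactor (β + 1) n) := by
  refine energy_of_equation ?_ α p
  have h := legendreP_equation (β + 1) n
  have e : (n : ℝ) * (n + 1) - (β + 1 : ℕ) * ((β + 1 : ℕ) + 1) =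
      ((n : ℝ) - (β + 1 : ℕ)) * (n + (β + 1 : ℕ) + 1) := by ring
  rw [legendreFactor, derivative_C_mul, derivative_C_mul, ← Function.iterate_succ_apply' derivative,
    ← Function.iterate_succ_apply' derivative, e]
  linear_combination (C (normConst (β + 1) n)) * h

/-! ### Orthonormality -/

theorem weightedIntegral_legendreFactor_self (m k : ℕ) :
    weightedIntegral (m + m) (legendreFactor m (m + k) * legendreFactor m (m + k)) = 1 := by
  have h := weightedIntegral_derivative_legendreP m k
  rw [legendreFactor, mul_mul_mul_comm, ← C_mul, weightedIntegral_C_mul, ← two_mul, h, normConst,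
    Real.mul_self_sqrt (by positivity), Nat.add_sub_cancel_left]
  have h1 : ((m + k + m).factorial : ℝ) ≠ 0 := by positivity
  have h2 : (k.factorial : ℝ) ≠ 0 := by positivity
  field_simp

/-- Eigenfunctions of a symmetric form for distinct eigenvalues are orthogonal; `n'(n'+1) - n(n+1) =
(n'-n)(n'+n+1)`. -/
theorem weightedIntegral_legendreFactor_of_ne {m n n' : ℕ} (hm : 1 ≤ m) (hn : n ≠ n') :
    weightedIntegral (m + m) (legendreFactor m n * legendreFactor m n') = 0 := by
  obtain ⟨β, rfl⟩ : ∃ β, m = β + 1 := ⟨m - 1, by omega⟩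
  have h1 := energy_legendreFactor β β n (legendreFactor (β + 1) n')
  have h2 := energy_legendreFactor β β n' (legendreFactor (β + 1) n)
  rw [energy_comm, h2, mul_comm (legendreFactor (β + 1) n')] at h1
  have h3 : ((n' : ℝ) - n) * (n' + n + 1) ≠ 0 := by
    refine mul_ne_zero (sub_ne_zero.2 (by exact_mod_cast hn.symm)) (by positivity)
  refine (mul_eq_zero.1 ?_).resolve_left h3
  linear_combination h1

theorem memLp_omega_pow_mul_eval (a : ℕ) (p : ℝ[X]) :
    MemLp (fun t => omega t ^ a * p.eval t) 2 (volume.restrict (Set.Ioo (-1 : ℝ) 1)) := by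
  have h := continuous_omega_pow_mul_eval a p
  obtain ⟨C, hC⟩ := (isCompact_Icc (a := (-1 : ℝ)) (b := 1)).exists_bound_of_continuousOn
    h.continuousOn
  refine MemLp.of_bound h.aestronglyMeasurable C ?_
  filter_upwards [ae_restrict_mem measurableSet_Ioo] with t ht
  exact hC t (Set.Ioo_subset_Icc_self ht)

/-- The function `ω^a p` as an element of `L²(-1,1)`. -/
def weightedPolynomial (a : ℕ) : ℝ[X] →ₗ[ℝ] L2 where
  toFun p := (memLp_omega_pow_mul_eval a p).toLp _
  map_add' p q := by
    rw [← MemLp.toLp_add]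
    refine MemLp.toLp_congr _ ((memLp_omega_pow_mul_eval a p).add (memLp_omega_pow_mul_eval a q))
      (Filter.Eventually.of_forall fun t => ?_)
    simp only [eval_add, Pi.add_apply]
    ring
  map_smul' c p := by
    rw [RingHom.id_apply, ← MemLp.toLp_const_smul]
    refine MemLp.toLp_congr _ ((memLp_omega_pow_mul_eval a p).const_smul c)
      (Filter.Eventually.of_forall fun t => ?_)
    simp only [eval_smul, Pi.smul_apply, smul_eq_mul]
    ring

theorem coeFn_weightedPolynomial (a : ℕ) (p : ℝ[X]) :
    weightedPolynomial a p =ᵐ[volume.restrict (Set.Ioo (-1 : ℝ) 1)]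
      fun t => omega t ^ a * p.eval t :=
  (memLp_omega_pow_mul_eval a p).coeFn_toLp

theorem Q_eq_weightedPolynomial (m n : ℕ) : Q m n = weightedPolynomial m (legendreFactor m n) := by
  refine MemLp.toLp_congr _ (memLp_omega_pow_mul_eval m (legendreFactor m n))
    (Filter.Eventually.of_forall fun t => ?_)
  simp only [legendreFun, legendreFactor, eval_mul, eval_C]
  ring

theorem inner_weightedPolynomial (a b : ℕ) (p q : ℝ[X]) :
    inner ℝ (weightedPolynomial a p) (weightedPolynomial b q) = weightedIntegral (a + b) (p * q) := by
  rw [L2.inner_def, weightedIntegral_apply, intervalIntegral.integral_of_le (by norm_num),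
    integral_Ioc_eq_integral_Ioo]
  refine integral_congr_ae ?_
  filter_upwards [coeFn_weightedPolynomial a p, coeFn_weightedPolynomial b q] with t h1 h2
  rw [h1, h2, eval_mul, pow_add, RCLike.inner_apply, conj_trivial]
  ring

theorem orthonormal_Q {m : ℕ} (hm : 1 ≤ m) : Orthonormal ℝ fun k => Q m (m + k) := by
  rw [orthonormal_iff_ite]
  intro k l
  simp only [Q_eq_weightedPolynomial, inner_weightedPolynomial]
  split_ifs with h
  · rw [h, weightedIntegral_legendreFactor_self]
  · exact weightedIntegral_legendreFactor_of_ne hm (by omega)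

/-! ### Comparison of the energy norms -/

/-- Bessel's inequality for the form of order `β+1`. With `r` the partial expansion over `F`, both
`a(p,r)` and `a(r,r)` equal the left side, and `2a(p,r) ≤ a(p,p) + a(r,r)`. -/
theorem sum_mul_inner_sq_le_energy (α β : ℕ) (p : ℝ[X]) (F : Finset ℕ) :
    ∑ k ∈ F, (((β + 1 + k : ℕ) : ℝ) * ((β + 1 + k : ℕ) + 1)) *
        (inner ℝ (weightedPolynomial (α + 1) p) (Q (β + 1) (β + 1 + k))) ^ 2
      ≤ energy (((β + 1 : ℕ) : ℝ) ^ 2) α α p p := by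
  set v : ℕ → ℝ := fun k => inner ℝ (weightedPolynomial (α + 1) p) (Q (β + 1) (β + 1 + k)) with hv
  set r : ℝ[X] := ∑ k ∈ F, v k • legendreFactor (β + 1) (β + 1 + k) with hr
  have hQ : ∀ a s k, weightedIntegral (a + (β + 1)) (s * legendreFactor (β + 1) (β + 1 + k)) =
      inner ℝ (weightedPolynomial a s) (Q (β + 1) (β + 1 + k)) := fun a s k => by
    rw [Q_eq_weightedPolynomial, inner_weightedPolynomial]
  have h1 : energy (((β + 1 : ℕ) : ℝ) ^ 2) α β p r =
      ∑ k ∈ F, (((β + 1 + k : ℕ) : ℝ) * ((β + 1 + k : ℕ) + 1)) * v k ^ 2 := by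
    rw [hr, map_sum]
    refine Finset.sum_congr rfl fun k _ => ?_
    rw [map_smul, energy_legendreFactor, hQ, smul_eq_mul]
    ring
  have h2 : energy (((β + 1 : ℕ) : ℝ) ^ 2) β β r r =
      ∑ k ∈ F, (((β + 1 + k : ℕ) : ℝ) * ((β + 1 + k : ℕ) + 1)) * v k ^ 2 := by
    conv_lhs => rw [hr, map_sum]
    refine Finset.sum_congr rfl fun k hk => ?_
    have h3 : inner ℝ (weightedPolynomial (β + 1) r) (Q (β + 1) (β + 1 + k)) = v k := by
      rw [hr, map_sum]
      simp only [map_smul, ← Q_eq_weightedPolynomial]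
      exact (orthonormal_Q (Nat.le_add_left 1 β)).inner_left_sum v hk
    rw [← hr, map_smul, energy_legendreFactor, hQ, smul_eq_mul, h3]
    ring
  have h := two_mul_energy_le (sq_nonneg ((β + 1 : ℕ) : ℝ)) α β p r
  rw [h1, h2] at h
  linarith

theorem energy_sum_legendreFactor (α : ℕ) (c : ℕ → ℝ) (G : Finset ℕ) :
    energy (((α + 1 : ℕ) : ℝ) ^ 2) α α (∑ j ∈ G, c j • legendreFactor (α + 1) (α + 1 + j))
        (∑ j ∈ G, c j • legendreFactor (α + 1) (α + 1 + j))
      = ∑ j ∈ G, (((α + 1 + j : ℕ) : ℝ) * ((α + 1 + j : ℕ) + 1)) * c j ^ 2 := by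
  set r : ℝ[X] := ∑ j ∈ G, c j • legendreFactor (α + 1) (α + 1 + j) with hr
  conv_lhs => rw [hr, map_sum]
  refine Finset.sum_congr rfl fun k hk => ?_
  have h3 : inner ℝ (weightedPolynomial (α + 1) r) (Q (α + 1) (α + 1 + k)) = c k := by
    rw [hr, map_sum]
    simp only [map_smul, ← Q_eq_weightedPolynomial]
    exact (orthonormal_Q (Nat.le_add_left 1 α)).inner_left_sum c hk
  rw [← hr, map_smul, energy_legendreFactor, ← inner_weightedPolynomial, ← Q_eq_weightedPolynomial,
    smul_eq_mul, h3]
  ring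

/-- The case `s = 1` of the comparison, for finite linear combinations of the `Q_n^{m'}`. -/
theorem sum_mul_inner_sq_le {m m' : ℕ} (hm : 1 ≤ m) (hm' : 1 ≤ m') {K : ℝ} (hK : 1 ≤ K)
    (hmK : (m : ℝ) ^ 2 ≤ K * (m' : ℝ) ^ 2) (c : ℕ → ℝ) (F G : Finset ℕ) :
    ∑ k ∈ F, (2 * ((m + k : ℕ) : ℝ) + 1) ^ 2 *
        (inner ℝ (∑ j ∈ G, c j • Q m' (m' + j)) (Q m (m + k))) ^ 2
      ≤ K * ∑ j ∈ G, (2 * ((m' + j : ℕ) : ℝ) + 1) ^ 2 * c j ^ 2 := by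
  obtain ⟨β, rfl⟩ : ∃ β, m = β + 1 := ⟨m - 1, by omega⟩
  obtain ⟨α, rfl⟩ : ∃ α, m' = α + 1 := ⟨m' - 1, by omega⟩
  set v : L2 := ∑ j ∈ G, c j • Q (α + 1) (α + 1 + j) with hv
  have hvp : v = weightedPolynomial (α + 1)
      (∑ j ∈ G, c j • legendreFactor (α + 1) (α + 1 + j)) := by
    simp only [hv, map_sum, map_smul, Q_eq_weightedPolynomial]
  have h1 := sum_mul_inner_sq_le_energy α β
    (∑ j ∈ G, c j • legendreFactor (α + 1) (α + 1 + j)) F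
  have h2 := energy_le_mul_energy hK hmK α (∑ j ∈ G, c j • legendreFactor (α + 1) (α + 1 + j))
  rw [energy_sum_legendreFactor] at h2
  rw [← hvp] at h1
  have h3 := (orthonormal_Q hm).sum_inner_products_le (x := v) (s := F)
  have h4 : ‖v‖ ^ 2 = ∑ j ∈ G, c j ^ 2 := by
    rw [← real_inner_self_eq_norm_sq, hv, (orthonormal_Q hm').inner_sum]
    simp [sq]
  have h5 : 0 ≤ ∑ j ∈ G, c j ^ 2 := Finset.sum_nonneg fun j _ => sq_nonneg _
  simp only [real_inner_comm v, Real.norm_eq_abs, sq_abs] at h3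
  -- The weight splits as `(2n+1)² = 4n(n+1) + 1`: the first part is bounded by energy, the second
  -- by Bessel's inequality and `K ≥ 1`.
  have e : ∀ (a : ℕ → ℝ) (S : Finset ℕ) (l : ℕ),
      ∑ k ∈ S, (2 * ((l + k : ℕ) : ℝ) + 1) ^ 2 * a k ^ 2 =
        4 * ∑ k ∈ S, (((l + k : ℕ) : ℝ) * ((l + k : ℕ) + 1)) * a k ^ 2 + ∑ k ∈ S, a k ^ 2 := by
    intro a S l
    rw [Finset.mul_sum, ← Finset.sum_add_distrib]
    exact Finset.sum_congr rfl fun k _ => by ring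
  rw [e, e c]
  nlinarith [mul_le_mul_of_nonneg_right hK h5]

/-! ### Completeness -/

theorem integral_continuous_mul_eq_zero {f : ℝ → ℝ} (hf : IntegrableOn f (Set.Ioo (-1) 1))
    (h : ∀ p : ℝ[X], ∫ t in Set.Ioo (-1 : ℝ) 1, p.eval t * f t = 0) {g : ℝ → ℝ}
    (hg : Continuous g) : ∫ t in Set.Ioo (-1 : ℝ) 1, g t * f t = 0 := by
  have hint : ∀ φ : ℝ → ℝ, Continuous φ → IntegrableOn (fun t => φ t * f t) (Set.Ioo (-1) 1) := by
    intro φ hφ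
    obtain ⟨C, hC⟩ := (isCompact_Icc (a := (-1 : ℝ)) (b := 1)).exists_bound_of_continuousOn
      hφ.continuousOn
    refine hf.bdd_mul hφ.aestronglyMeasurable (c := C) ?_
    filter_upwards [ae_restrict_mem measurableSet_Ioo] with t ht
    exact hC t (Set.Ioo_subset_Icc_self ht)
  set M := ∫ t in Set.Ioo (-1 : ℝ) 1, |f t| with hM
  have hM0 : 0 ≤ M := integral_nonneg fun t => abs_nonneg _
  rw [← abs_eq_zero]
  refine le_antisymm (le_of_forall_pos_le_add fun ε hε => ?_) (abs_nonneg _)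
  -- Weierstrass approximation; dividing by `M + 1` covers the case `M = 0`.
  obtain ⟨p, hp⟩ := exists_polynomial_near_of_continuousOn (-1) 1 g hg.continuousOn (ε / (M + 1))
    (by positivity)
  have e : ∫ t in Set.Ioo (-1 : ℝ) 1, g t * f t =
      ∫ t in Set.Ioo (-1 : ℝ) 1, (g t * f t - p.eval t * f t) := by
    rw [integral_sub (hint g hg) (hint _ p.continuous), h p, sub_zero]
  rw [e, zero_add]
  calc |∫ t in Set.Ioo (-1 : ℝ) 1, (g t * f t - p.eval t * f t)|
      ≤ ∫ t in Set.Ioo (-1 : ℝ) 1, ε / (M + 1) * |f t| := by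
        rw [← Real.norm_eq_abs]
        refine norm_integral_le_of_norm_le (hf.norm.const_mul _) ?_
        filter_upwards [ae_restrict_mem measurableSet_Ioo] with t ht
        rw [← sub_mul, Real.norm_eq_abs, abs_mul, abs_sub_comm]
        exact mul_le_mul_of_nonneg_right (hp t (Set.Ioo_subset_Icc_self ht)).le (abs_nonneg _)
    _ = ε / (M + 1) * M := integral_const_mul _ _
    _ = ε * (M / (M + 1)) := by ring
    _ ≤ ε := mul_le_of_le_one_right hε.le ((div_le_one (by positivity)).2 (by linarith))

theorem eq_zero_of_inner_weightedPolynomial (m : ℕ) {u : L2}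
    (h : ∀ p, inner ℝ u (weightedPolynomial m p) = 0) : u = 0 := by
  have hint : IntegrableOn (fun t => omega t ^ m * u t) (Set.Ioo (-1) 1) := by
    have h1 := (memLp_omega_pow_mul_eval m 1).integrable_mul (Lp.memLp u)
    refine h1.congr (Filter.Eventually.of_forall fun t => ?_)
    simp
  have hp : ∀ p : ℝ[X], ∫ t in Set.Ioo (-1 : ℝ) 1, p.eval t * (omega t ^ m * u t) = 0 := by
    intro p
    rw [← h p, L2.inner_def]
    refine integral_congr_ae ?_
    filter_upwards [coeFn_weightedPolynomial m p] with t ht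
    rw [ht, RCLike.inner_apply, conj_trivial]
    ring
  have h0 := isOpen_Ioo.ae_eq_zero_of_integral_contDiff_smul_eq_zero hint.locallyIntegrableOn
    fun g hg _ hsupp => by
      rw [← integral_continuous_mul_eq_zero hint hp hg.continuous,
        setIntegral_eq_integral_of_forall_compl_eq_zero]
      · rfl
      · intro t ht
        rw [image_eq_zero_of_notMem_tsupport fun h' => ht (hsupp h'), zero_mul]
  rw [Lp.eq_zero_iff_ae_eq_zero]
  refine (ae_restrict_iff' measurableSet_Ioo).2 ?_
  filter_upwards [h0] with t ht hmem
  exact (mul_eq_zero.1 (ht hmem)).resolve_left (pow_ne_zero _ (omega_pos hmem).ne')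

/-- The polynomial `P_{m+k}^{(m)}` has degree exactly `k`, so these span all polynomials. -/
theorem eq_zero_of_inner_Q (m : ℕ) {u : L2} (h : ∀ k, inner ℝ u (Q m (m + k)) = 0) : u = 0 := by
  let S : Polynomial.Sequence ℝ :=
    ⟨fun k => derivative^[m] (legendreP (m + k)), degree_derivative_legendreP m⟩
  have hS := S.span fun k => (leadingCoeff_ne_zero.2 (S.ne_zero k)).isUnit
  have hker : Submodule.span ℝ (Set.range S) ≤
      LinearMap.ker ((innerSL ℝ u).toLinearMap ∘ₗ weightedPolynomial m) := by
    rw [Submodule.span_le]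
    rintro _ ⟨k, rfl⟩
    have hk := h k
    have hc : normConst m (m + k) ≠ 0 := (Real.sqrt_pos.2 (by positivity)).ne'
    rw [Q_eq_weightedPolynomial, legendreFactor, ← smul_eq_C_mul, map_smul, inner_smul_right] at hk
    exact (mul_eq_zero.1 hk).resolve_left hc
  rw [hS] at hker
  exact eq_zero_of_inner_weightedPolynomial m fun p => hker (Submodule.mem_top (x := p))

/-- The Hilbert basis `(Q_n^m)_{n ≥ m}` of `L²(-1,1)`, for `m ≥ 1`. -/
def basisQ {m : ℕ} (hm : 1 ≤ m) : HilbertBasis ℕ ℝ L2 :=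
  HilbertBasis.mkOfOrthogonalEqBot (orthonormal_Q hm) <| by
    rw [Submodule.eq_bot_iff]
    intro u hu
    refine eq_zero_of_inner_Q m fun k => ?_
    rw [real_inner_comm]
    exact hu _ (Submodule.subset_span ⟨k, rfl⟩)

theorem basisQ_apply {m : ℕ} (hm : 1 ≤ m) (k : ℕ) : basisQ hm k = Q m (m + k) := by
  rw [basisQ, HilbertBasis.coe_mkOfOrthogonalEqBot]

/-! ### Interpolation between weighted `ℓ²` norms -/

section Interpolation

variable {E : Type*} [NormedAddCommGroup E] [InnerProductSpace ℝ E] {e : ℕ → E}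
  {b : HilbertBasis ℕ ℝ E} {x y : ℕ → ℝ} {K : ℝ}

theorem hasSum_inner_sq (b : HilbertBasis ℕ ℝ E) (u : E) :
    HasSum (fun j => inner ℝ u (b j) ^ 2) (‖u‖ ^ 2) := by
  have h := b.hasSum_inner_mul_inner u u
  rw [real_inner_self_eq_norm_sq] at h
  refine h.congr_fun fun j => ?_
  rw [real_inner_comm u, sq]

/-- The left side is the minimum of the right side over all splittings of the given sum `a + c`. -/
theorem mul_add_sq_le {t x : ℝ} (ht : 0 < t) (hx : 0 < x) (a c : ℝ) :
    x / (t + x) * (a + c) ^ 2 ≤ a ^ 2 + x * c ^ 2 / t := by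
  rw [div_mul_eq_mul_div, div_le_iff₀ (by positivity)]
  have : (a ^ 2 + x * c ^ 2 / t) * (t + x) - x * (a + c) ^ 2 = (t * a - x * c) ^ 2 / t := by
    field_simp
    ring
  have h2 : 0 ≤ (t * a - x * c) ^ 2 / t := by positivity
  linarith

/-- A K-functional argument: the resolvent sum is the infimum of `‖u-v‖² + ‖v‖₁²/t` over `v`, with
`‖·‖₁` the norm of weight `x` or `y`. Any `v` bounds the left side from above, and the near-optimal
`v` for the weights `y` is inserted. -/
theorem sum_resolvent_le_tsum (he : Orthonormal ℝ e) (hx : ∀ k, 0 < x k) (hy : ∀ j, 0 < y j)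
    (hK : 1 ≤ K)
    (hxy : ∀ (c : ℕ → ℝ) (F G : Finset ℕ),
      ∑ k ∈ F, x k * inner ℝ (∑ j ∈ G, c j • b j) (e k) ^ 2 ≤ K * ∑ j ∈ G, y j * c j ^ 2)
    {t : ℝ} (ht : 0 < t) (u : E) (F : Finset ℕ) :
    ∑ k ∈ F, x k / (t + x k) * inner ℝ u (e k) ^ 2 ≤
      K * ∑' j, y j / (t + y j) * inner ℝ u (b j) ^ 2 := by
  have hu := hasSum_inner_sq b u
  have hs : Summable fun j => y j / (t + y j) * inner ℝ u (b j) ^ 2 := by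
    refine Summable.of_nonneg_of_le (fun j => ?_) (fun j => ?_) hu.summable
    · have := hy j
      positivity
    · have := hy j
      exact mul_le_of_le_one_left (sq_nonneg _) ((div_le_one (by positivity)).2 (by linarith))
  have hlim : Filter.Tendsto (fun G : Finset ℕ => (‖u‖ ^ 2 - ∑ j ∈ G, inner ℝ u (b j) ^ 2) +
      K * ∑ j ∈ G, y j / (t + y j) * inner ℝ u (b j) ^ 2) Filter.atTop
      (nhds ((‖u‖ ^ 2 - ‖u‖ ^ 2) + K * ∑' j, y j / (t + y j) * inner ℝ u (b j) ^ 2)) :=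
    (hu.const_sub _).add (hs.hasSum.const_mul _)
  rw [sub_self, zero_add] at hlim
  refine ge_of_tendsto' hlim fun G => ?_
  -- The coordinatewise minimizer for the weights `y`, truncated to `G` because `hxy` is known only
  -- for finite sums; the tail of `‖u‖²` vanishes in the limit.
  set c : ℕ → ℝ := fun j => t / (t + y j) * inner ℝ u (b j) with hc
  set v : E := ∑ j ∈ G, c j • b j with hv
  have h1 : ∑ k ∈ F, x k / (t + x k) * inner ℝ u (e k) ^ 2 ≤
      ∑ k ∈ F, inner ℝ (u - v) (e k) ^ 2 + (∑ k ∈ F, x k * inner ℝ v (e k) ^ 2) / t := by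
    rw [Finset.sum_div, ← Finset.sum_add_distrib]
    refine Finset.sum_le_sum fun k _ => ?_
    have := mul_add_sq_le ht (hx k) (inner ℝ (u - v) (e k)) (inner ℝ v (e k))
    rwa [← inner_add_left, sub_add_cancel] at this
  have h2 : ∑ k ∈ F, inner ℝ (u - v) (e k) ^ 2 ≤ ‖u - v‖ ^ 2 := by
    have := he.sum_inner_products_le (x := u - v) (s := F)
    simpa only [real_inner_comm (u - v), Real.norm_eq_abs, sq_abs] using this
  have h3 : ‖u - v‖ ^ 2 = (‖u‖ ^ 2 - ∑ j ∈ G, inner ℝ u (b j) ^ 2) +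
      ∑ j ∈ G, (inner ℝ u (b j) - c j) ^ 2 := by
    have hvv : ‖v‖ ^ 2 = ∑ j ∈ G, c j ^ 2 := by
      rw [← real_inner_self_eq_norm_sq, hv, b.orthonormal.inner_sum]
      simp [sq]
    have huv : inner ℝ u v = ∑ j ∈ G, c j * inner ℝ u (b j) := by
      rw [hv, inner_sum]
      exact Finset.sum_congr rfl fun j _ => inner_smul_right _ _ _
    rw [norm_sub_sq_real, hvv, huv, Finset.mul_sum, sub_add, sub_add, ← Finset.sum_sub_distrib,
      ← Finset.sum_sub_distrib]
    congr 1
    exact Finset.sum_congr rfl fun j _ => by ring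
  have h4 : ∑ j ∈ G, (inner ℝ u (b j) - c j) ^ 2 + K * (∑ j ∈ G, y j * c j ^ 2) / t ≤
      K * ∑ j ∈ G, y j / (t + y j) * inner ℝ u (b j) ^ 2 := by
    rw [mul_div_assoc, Finset.sum_div, Finset.mul_sum, Finset.mul_sum, ← Finset.sum_add_distrib]
    refine Finset.sum_le_sum fun j _ => ?_
    have hyj := hy j
    have e1 : (inner ℝ u (b j) - c j) ^ 2 = (y j / (t + y j) * inner ℝ u (b j)) ^ 2 := by
      simp only [hc]
      field_simp
      ring
    have e2 : y j / (t + y j) * inner ℝ u (b j) ^ 2 =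
        (y j / (t + y j) * inner ℝ u (b j)) ^ 2 + y j * c j ^ 2 / t := by
      simp only [hc]
      field_simp
      ring
    rw [e1, e2, mul_add]
    gcongr
    exact le_mul_of_one_le_left (sq_nonneg _) hK
  have h5 := div_le_div_of_nonneg_right (hxy c F G) ht.le
  linarith

theorem sum_rpow_mul_inner_sq_le_tsum (he : Orthonormal ℝ e) (hx : ∀ k, 0 < x k)
    (hy : ∀ j, 0 < y j) (hK : 1 ≤ K)
    (hxy : ∀ (c : ℕ → ℝ) (F G : Finset ℕ),
      ∑ k ∈ F, x k * inner ℝ (∑ j ∈ G, c j • b j) (e k) ^ 2 ≤ K * ∑ j ∈ G, y j * c j ^ 2)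
    {s : ℝ} (hs0 : 0 ≤ s) (hs1 : s ≤ 1) (u : E)
    (hu : Summable fun j => y j ^ s * inner ℝ u (b j) ^ 2) (F : Finset ℕ) :
    ∑ k ∈ F, x k ^ s * inner ℝ u (e k) ^ 2 ≤ K * ∑' j, y j ^ s * inner ℝ u (b j) ^ 2 := by
  rcases hs0.eq_or_lt with rfl | hs0
  · simp only [Real.rpow_zero, one_mul]
    have h := he.sum_inner_products_le (x := u) (s := F)
    simp only [real_inner_comm u, Real.norm_eq_abs, sq_abs] at h
    rw [(hasSum_inner_sq b u).tsum_eq]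
    exact h.trans (le_mul_of_one_le_left (sq_nonneg _) hK)
  rcases hs1.eq_or_lt with rfl | hs1
  · simp only [Real.rpow_one] at hu ⊢
    -- The endpoint `s = 1` is recovered from `t · x/(t+x) → x` as `t → ∞`.
    have hlim : Filter.Tendsto (fun t : ℝ => ∑ k ∈ F, t / (t + x k) * (x k * inner ℝ u (e k) ^ 2))
        Filter.atTop (nhds (∑ k ∈ F, 1 * (x k * inner ℝ u (e k) ^ 2))) := by
      refine tendsto_finsetSum _ fun k _ => Filter.Tendsto.mul_const _ ?_
      have h1 : Filter.Tendsto (fun t : ℝ => 1 - x k / (t + x k)) Filter.atTop (nhds (1 - 0)) :=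
        ((Filter.tendsto_atTop_add_const_right _ _ Filter.tendsto_id).const_div_atTop _).const_sub _
      rw [sub_zero] at h1
      refine h1.congr' ?_
      filter_upwards [Filter.eventually_gt_atTop 0] with t ht
      have := hx k
      field_simp
      ring
    simp only [one_mul] at hlim
    refine le_of_tendsto hlim ?_
    filter_upwards [Filter.eventually_gt_atTop 0] with t ht
    have h := mul_le_mul_of_nonneg_left (sum_resolvent_le_tsum he hx hy hK hxy ht u F) ht.le
    rw [Finset.mul_sum, mul_left_comm, ← tsum_mul_left] at h
    refine (le_of_eq (Finset.sum_congr rfl fun k _ => by ring)).trans (h.trans ?_)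
    refine mul_le_mul_of_nonneg_left ?_ (by linarith)
    have hle : ∀ j, t * (y j / (t + y j) * inner ℝ u (b j) ^ 2) ≤ y j * inner ℝ u (b j) ^ 2 := by
      intro j
      have hyj := hy j
      rw [← mul_assoc]
      refine mul_le_mul_of_nonneg_right ?_ (sq_nonneg _)
      rw [mul_div_assoc', div_le_iff₀ (by positivity)]
      nlinarith
    refine Summable.tsum_le_tsum hle (Summable.of_nonneg_of_le (fun j => ?_) hle hu) hu
    have hyj := hy j
    positivity
  have hs : s ∈ Set.Ioo (0 : ℝ) 1 := ⟨hs0, hs1⟩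
  -- This represents `x^s` as `∫ t^{s-1} x/(t+x) dμ(t)` over `t > 0`, so the resolvent inequality
  -- can be integrated in `t`.
  obtain ⟨μ, hμ⟩ := Real.exists_measure_rpow_eq_integral_rpowIntegrand₀₁ hs
  set R := Real.rpowIntegrand₀₁ s with hR
  have hint : ∀ (a c : ℝ), 0 < a →
      Integrable (fun t => R t a * c) (μ.restrict (Set.Ioi 0)) ∧
        ∫ t in Set.Ioi 0, R t a * c ∂μ = a ^ s * c := fun a c ha =>
    ⟨(hμ a ha.le).1.mul_const c, by rw [integral_mul_const, ← (hμ a ha.le).2]⟩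
  have hnorm : ∀ j, ∫ t in Set.Ioi 0, ‖R t (y j) * inner ℝ u (b j) ^ 2‖ ∂μ =
      y j ^ s * inner ℝ u (b j) ^ 2 := by
    intro j
    rw [← (hint (y j) _ (hy j)).2]
    refine setIntegral_congr_fun measurableSet_Ioi fun t ht => Real.norm_of_nonneg ?_
    exact mul_nonneg (Real.rpowIntegrand₀₁_nonneg hs0 (le_of_lt ht) (hy j).le) (sq_nonneg _)
  have hsum := hasSum_integral_of_summable_integral_norm (μ := μ.restrict (Set.Ioi 0))
    (F := fun j t => R t (y j) * inner ℝ u (b j) ^ 2) (fun j => (hint (y j) _ (hy j)).1)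
    (by simpa only [hnorm] using hu)
  simp only [(hint (y _) _ (hy _)).2] at hsum
  have hpt : ∀ t ∈ Set.Ioi (0 : ℝ), ∑ k ∈ F, R t (x k) * inner ℝ u (e k) ^ 2 ≤
      K * ∑' j, R t (y j) * inner ℝ u (b j) ^ 2 := by
    intro t ht
    have ht' : (0 : ℝ) < t := ht
    have e1 : ∀ a : ℝ, 0 < a → ∀ c, R t a * c = t ^ (s - 1) * (a / (t + a) * c) := by
      intro a ha c
      rw [hR, Real.rpowIntegrand₀₁_eq_pow_div hs ht'.le ha.le]
      ring
    simp only [e1 _ (hx _), e1 _ (hy _)]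
    rw [← Finset.mul_sum, tsum_mul_left, mul_left_comm]
    exact mul_le_mul_of_nonneg_left (sum_resolvent_le_tsum he hx hy hK hxy ht' u F)
      (Real.rpow_nonneg ht'.le _)
  have hF : ∑ k ∈ F, x k ^ s * inner ℝ u (e k) ^ 2 =
      ∫ t in Set.Ioi 0, ∑ k ∈ F, R t (x k) * inner ℝ u (e k) ^ 2 ∂μ := by
    rw [integral_finsetSum _ fun k _ => (hint (x k) _ (hx k)).1]
    exact Finset.sum_congr rfl fun k _ => ((hint (x k) _ (hx k)).2).symm
  rw [hF, hsum.tsum_eq, ← integral_const_mul]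
  have hI : Integrable (fun t => ∑' j, R t (y j) * inner ℝ u (b j) ^ 2)
      (μ.restrict (Set.Ioi 0)) := by
    -- A non-integrable function has integral `0` by convention. Then every term of the nonnegative
    -- sum vanishes, so all coefficients of `u` do, and the integrand is zero, hence integrable.
    by_contra hI
    rw [integral_undef hI, hasSum_zero_iff_of_nonneg fun j =>
      mul_nonneg (Real.rpow_nonneg (hy j).le s) (sq_nonneg _)] at hsum
    refine hI ((integrable_zero ℝ ℝ _).congr (Filter.Eventually.of_forall fun t => ?_))
    have h0 : ∀ j, inner ℝ u (b j) ^ 2 = 0 := fun j =>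
      (mul_eq_zero.1 (congrFun hsum j)).resolve_left (Real.rpow_pos_of_pos (hy j) s).ne'
    simp only [h0, mul_zero, tsum_zero, Pi.zero_apply]
  exact setIntegral_mono_on (integrable_finsetSum _ fun k _ => (hint (x k) _ (hx k)).1)
    (hI.const_mul K) measurableSet_Ioi hpt

end Interpolation

/-! ### Comparison of the scales -/

/-- The comparison of weighted sums that holds for `0 ≤ s ≤ 1`. -/
theorem scaleNorm_le {m m' : ℕ} (hm : 1 ≤ m) (hm' : 1 ≤ m') {s : ℝ} (hs0 : 0 ≤ s)
    (hs1 : s ≤ 1) {u : L2} (hu : u ∈ H m' s) :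
    u ∈ H m s ∧ scaleNorm m s u ≤ m * scaleNorm m' s u := by
  have hmR : (1 : ℝ) ≤ m := by exact_mod_cast hm
  have hmR' : (1 : ℝ) ≤ m' := by exact_mod_cast hm'
  -- The constant `K = m²` is a convenient bound for `max(1, m²/m'²)`; its square root is the factor
  -- `m` in the norm estimate.
  have hK : (1 : ℝ) ≤ (m : ℝ) ^ 2 := one_le_pow₀ hmR
  have hmK : (m : ℝ) ^ 2 ≤ (m : ℝ) ^ 2 * (m' : ℝ) ^ 2 :=
    le_mul_of_one_le_right (sq_nonneg _) (one_le_pow₀ hmR')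
  have hterm : ∀ l : ℕ, weightedTerm l s u = fun k =>
      ((2 * ((l + k : ℕ) : ℝ) + 1) ^ 2) ^ s * inner ℝ u (Q l (l + k)) ^ 2 := by
    intro l
    funext k
    rw [weightedTerm, Real.rpow_mul (by positivity), Real.rpow_two]
  change Summable (weightedTerm m' s u) at hu
  have key : ∀ F : Finset ℕ, ∑ k ∈ F, weightedTerm m s u k ≤
      (m : ℝ) ^ 2 * ∑' j, weightedTerm m' s u j := by
    intro F
    simp only [hterm, ← basisQ_apply hm'] at hu ⊢
    refine sum_rpow_mul_inner_sq_le_tsum (orthonormal_Q hm) (fun k => by positivity)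
      (fun j => by positivity) hK ?_ hs0 hs1 u hu F
    simp only [basisQ_apply]
    exact sum_mul_inner_sq_le hm hm' hK hmK
  refine ⟨summable_of_sum_le (weightedTerm_nonneg m s u) key, ?_⟩
  rw [scaleNorm, scaleNorm, ← Real.sqrt_sq (Nat.cast_nonneg (α := ℝ) m),
    ← Real.sqrt_mul (sq_nonneg _)]
  exact Real.sqrt_le_sqrt (Real.tsum_le_of_sum_le (weightedTerm_nonneg m s u) key)

theorem H_eq {m m' : ℕ} (hm : 1 ≤ m) (hm' : 1 ≤ m') {s : ℝ} (hs0 : 0 ≤ s) (hs1 : s ≤ 1) :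
    H m s = H m' s :=
  le_antisymm (fun _ hu => (scaleNorm_le hm' hm hs0 hs1 hu).1)
    fun _ hu => (scaleNorm_le hm hm' hs0 hs1 hu).1

theorem scaleNorm_nonneg (m : ℕ) (s : ℝ) (u : L2) : 0 ≤ scaleNorm m s u := Real.sqrt_nonneg _

theorem Hdual_subset {m m' : ℕ} (hm : 1 ≤ m) (hm' : 1 ≤ m') {σ : ℝ} (h0 : 0 ≤ σ) (h1 : σ ≤ 1) :
    Hdual m σ ⊆ Hdual m' σ := by
  rintro f ⟨hf, K, hK⟩
  -- The bound `K` carries no sign, so `|K|` is used to keep the inequalities monotone.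
  refine ⟨hf.trans (H_eq hm hm' h0 h1), |K| * m, fun v => (hK v).trans ?_⟩
  have hv : (v : L2) ∈ H m' σ := by
    rw [← H_eq hm hm' h0 h1, ← hf]
    exact v.2
  calc K * scaleNorm m σ (v : L2)
      ≤ |K| * scaleNorm m σ (v : L2) :=
        mul_le_mul_of_nonneg_right (le_abs_self K) (scaleNorm_nonneg _ _ _)
    _ ≤ |K| * (m * scaleNorm m' σ (v : L2)) :=
        mul_le_mul_of_nonneg_left (scaleNorm_le hm hm' h0 h1 hv).2 (abs_nonneg K)
    _ = |K| * m * scaleNorm m' σ (v : L2) := by ring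

/-- Duality reverses the comparison: if `L` bounds `f` for order `m`, then `L * m` bounds it for
order `m'`. -/
theorem dualNorm_le {m m' : ℕ} (hm : 1 ≤ m) (hm' : 1 ≤ m') {σ : ℝ} (h0 : 0 ≤ σ) (h1 : σ ≤ 1)
    {f : L2 →ₗ.[ℝ] ℝ} (hf : f ∈ Hdual m σ) : dualNorm m' σ f ≤ m * dualNorm m σ f := by
  obtain ⟨hdom, K, hK⟩ := hf
  have hmpos : (0 : ℝ) < m := by exact_mod_cast hm
  have hne : {K : ℝ | 0 ≤ K ∧ ∀ v : f.domain, |f v| ≤ K * scaleNorm m σ (v : L2)}.Nonempty :=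
    ⟨|K|, abs_nonneg K, fun v => (hK v).trans
      (mul_le_mul_of_nonneg_right (le_abs_self K) (scaleNorm_nonneg _ _ _))⟩
  rw [mul_comm, ← div_le_iff₀ hmpos]
  refine le_csInf hne ?_
  rintro L ⟨hL0, hL⟩
  rw [div_le_iff₀ hmpos]
  refine csInf_le ⟨0, fun _ h => h.1⟩ ⟨by positivity, fun v => (hL v).trans ?_⟩
  have hv : (v : L2) ∈ H m' σ := by
    rw [← H_eq hm hm' h0 h1, ← hdom]
    exact v.2
  rw [mul_assoc]
  exact mul_le_mul_of_nonneg_left (scaleNorm_le hm hm' h0 h1 hv).2 hL0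

end LegendreScale

end

theorem mainTheorem5 (m m' : ℕ) (hm : 1 ≤ m) (hm' : 1 ≤ m') (s : ℝ)
    (hs₁ : -1 ≤ s) (hs₂ : s ≤ 1) :
    (0 ≤ s →
      LegendreScale.H m s = LegendreScale.H m' s ∧
      ∃ c C : ℝ, 0 < c ∧ 0 < C ∧ ∀ u ∈ LegendreScale.H m s,
        c * LegendreScale.scaleNorm m' s u ≤ LegendreScale.scaleNorm m s u ∧
        LegendreScale.scaleNorm m s u ≤ C * LegendreScale.scaleNorm m' s u) ∧
    (s < 0 →
      LegendreScale.Hdual m (-s) = LegendreScale.Hdual m' (-s) ∧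
      ∃ c C : ℝ, 0 < c ∧ 0 < C ∧ ∀ f ∈ LegendreScale.Hdual m (-s),
        c * LegendreScale.dualNorm m' (-s) f ≤ LegendreScale.dualNorm m (-s) f ∧
        LegendreScale.dualNorm m (-s) f ≤ C * LegendreScale.dualNorm m' (-s) f) := by
  have hmpos : (0 : ℝ) < m := by exact_mod_cast hm
  have hmpos' : (0 : ℝ) < m' := by exact_mod_cast hm'
  constructor
  · intro h0
    have hH := LegendreScale.H_eq hm hm' h0 hs₂
    refine ⟨hH, (m' : ℝ)⁻¹, m, inv_pos.2 hmpos', hmpos, fun u hu => ⟨?_, ?_⟩⟩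
    · rw [inv_mul_le_iff₀ hmpos']
      exact (LegendreScale.scaleNorm_le hm' hm h0 hs₂ hu).2
    · exact (LegendreScale.scaleNorm_le hm hm' h0 hs₂ (hH ▸ hu)).2
  · intro hneg
    have h0 : 0 ≤ -s := by linarith
    have h1 : -s ≤ 1 := by linarith
    have hsub := LegendreScale.Hdual_subset hm hm' h0 h1
    refine ⟨hsub.antisymm (LegendreScale.Hdual_subset hm' hm h0 h1), (m : ℝ)⁻¹, m',
      inv_pos.2 hmpos, hmpos', fun f hf => ⟨?_, ?_⟩⟩
    · rw [inv_mul_le_iff₀ hmpos]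
      exact LegendreScale.dualNorm_le hm hm' h0 h1 hf
    · exact LegendreScale.dualNorm_le hm' hm h0 h1 (hsub hf)
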